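/- Let $R$ be a commutative ring (not required to contain $1$), $\delta\colon R\to R$ a derivation, i.e. an additive map with $\delta(ab)=a\,\delta b+\delta a\, b$, and let $0\le j<N$ and $0\le k\le N-j$ be integers. Let $\mathbf f=(f_1,\dots,f_N)$ be elements of $R$ and $\mathbf u=(u_1,\dots,u_k)$ non-negative integers. Let $S(N,m)$ be the set of set partitions $s=(s_1,\dots,s_m)$ of $\{1,\dots,N\}$ into $m$ non-empty blocks, numbered so that $\min s_1<\dots<\min s_m$, and let $T(m,k)$ be the set of strictly increasing functions $\tau\colon\{1,\dots,k\}\to\{1,\dots,m\}$ (one element if $k=0$). Put $$F(j,\mathbf f,\mathbf u)=\sum_{\tau\in T(N-j,k)}\ \sum_{s\in S(N,N-j)}\Bigl(\prod_{i=1}^k\binom{|s_{\tau(i)}|-1}{u_i}\,\delta^{|s_{\tau(i)}|-1-u_i}\prod_{h\in s_{\tau(i)}}f_h\Bigr)\Bigl(\prod_{i\notin\operatorname{im}\tau}\delta^{|s_i|-1}\prod_{h\in s_i}f_h\Bigr),$$ where a term with $|s_{\tau(i)}|-1<u_i$ for some $i$ is $0$. If $\sum_{i=1}^k u_i\le j$,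 put $$C(j,N,\mathbf u)=\frac{(N-1)!\,\bigl(N-j+\sum_{i=1}^k u_i\bigr)}{(N-j-k)!\,\bigl(j-\sum_{i=1}^k u_i\bigr)!\,\prod_{i=1}^k u_i!\,\prod_{i=1}^k\bigl(k-i+1+\sum_{g=i}^k u_g\bigr)}.$$ Then, if $\sum_i u_i\le j$, the number $C(j,N,\mathbf u)$ is a non-negative integer and $$F(j,\mathbf f,\mathbf u)=C(j,N,\mathbf u)\,\delta^{\,j-\sum_{i=1}^k u_i}\prod_{i=1}^N f_i .$$ If $\sum_i u_i>j$, then $F(j,\mathbf f,\mathbf u)=0$. -/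

import Mathlib

namespace DerivPartition

/-- `setPartitions N m` is the set `S(N, m)` of set partitions of an `N`-element chain into `m`
parts: `m`-tuples of pairwise disjoint non-empty subsets with union everything, listed in
increasing order of their minima. (Elements `1, …, N` are indexed by `Fin N`.) -/
def setPartitions (N m : ℕ) : Finset (Fin m → Finset (Fin N)) :=
  Finset.univ.filter fun s =>
    (∀ i, (s i).Nonempty) ∧
    (∀ i i', i ≠ i' → Disjoint (s i) (s i')) ∧
    Finset.univ.biUnion s = Finset.univ ∧
    (∀ i i', i < i' → (s i).min < (s i').min)

/-- `markings m k` is the set `T(m, k)` of strictly increasing functions `[1, k] → [1, m]`. -/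
def markings (m k : ℕ) : Finset (Fin k → Fin m) :=
  Finset.univ.filter fun τ => ∀ a b, a < b → τ a < τ b

section Products

/-- The element of `R` underlying an element of `WithOne R` (that is, of `R` with an identity
adjoined); the adjoined identity itself, i.e. the empty product, gets the unused value `0`. -/
def value {R : Type*} [NonUnitalCommRing R] (x : WithOne R) : R :=
  x.unoneD 0

/-- The product `∏ h ∈ A, f h` over a non-empty finite set `A` in a commutative ring that need
not have an identity. -/
def prodOver {R : Type*} [NonUnitalCommRing R] {ι : Type*} (A : Finset ι) (f : ι → R) : R :=
  value (∏ h ∈ A, (f h : WithOne R))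

end Products

/-- The sum `F(j, f, u)`. The products over `i ∈ [1, k]` and over `i ∉ τ` may be empty
separately, but not both, so their product is formed in `WithOne R` and read back in `R`. -/
def F {R : Type*} [NonUnitalCommRing R] (δ : R → R) {N : ℕ} (j : ℕ) (f : Fin N → R)
    {k : ℕ} (u : Fin k → ℕ) : R :=
  ∑ τ ∈ markings (N - j) k, ∑ s ∈ setPartitions N (N - j),
    value
      ((∏ i : Fin k,
          ((((s (τ i)).card - 1).choose (u i) •
            δ^[(s (τ i)).card - 1 - u i] (prodOver (s (τ i)) f) : R) : WithOne R)) *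
        ∏ i ∈ (Finset.univ.image τ)ᶜ,
          ((δ^[(s i).card - 1] (prodOver (s i) f) : R) : WithOne R))

/-- The number `C(j, N, u)`, for `j < N`, `k ≤ N - j` and `∑ u_i ≤ j`. The index `i : Fin k`
stands for `i + 1 ∈ [1, k]`, so `k - (i + 1) + 1` reads `k - i`. -/
def C (j N : ℕ) {k : ℕ} (u : Fin k → ℕ) : ℚ :=
  ((N - 1).factorial * ((N : ℚ) - j + ∑ i, (u i : ℚ))) /
    ((N - j - k).factorial * (j - ∑ i, u i).factorial * (∏ i, ((u i).factorial : ℚ)) *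
      ∏ i : Fin k, ((k : ℚ) - (i : ℕ) + ∑ g ∈ Finset.Ici i, (u g : ℚ)))

section Unital

/-- In a ring with identity, `value` is the evaluation of products, apart from the empty one. -/
theorem value_eq_lift {R : Type*} [CommRing R] (x : WithOne R) (hx : x ≠ 1) :
    value x = WithOne.lift (MulHom.id R) x := by
  induction x using WithOne.recOneCoe with
  | one => exact absurd rfl hx
  | coe a => simp [value]

theorem prod_coe_eq_one {R : Type*} [CommSemigroup R] {ι : Type*} (A : Finset ι) (f : ι → R)
    (h : ∏ h ∈ A, (f h : WithOne R) = 1) : A = ∅ := by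
  classical
  induction A using Finset.induction_on with
  | empty => rfl
  | insert a A ha _ =>
    exfalso
    rw [Finset.prod_insert ha] at h
    generalize (∏ h ∈ A, (f h : WithOne R)) = y at h
    induction y using WithOne.recOneCoe with
    | one => rw [mul_one] at h; exact WithOne.coe_ne_one h
    | coe b => rw [← WithOne.coe_mul] at h; exact WithOne.coe_ne_one h

/-- In a ring with identity, `prodOver` is the usual product over non-empty sets. -/
theorem prodOver_eq_prod {R : Type*} [CommRing R] {ι : Type*} (A : Finset ι) (f : ι → R)
    (hA : A.Nonempty) : prodOver A f = ∏ h ∈ A, f h := by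
  rw [prodOver, value_eq_lift _ fun h => hA.ne_empty (prod_coe_eq_one A f h), map_prod]
  simp

/-- In a ring with identity, `F` is given by the usual products. -/
theorem F_eq {R : Type*} [CommRing R] (δ : R → R) {N : ℕ} (j : ℕ) (hj : j < N) (f : Fin N → R)
    {k : ℕ} (u : Fin k → ℕ) :
    F δ j f u = ∑ τ ∈ markings (N - j) k, ∑ s ∈ setPartitions N (N - j),
      (∏ i : Fin k, ((s (τ i)).card - 1).choose (u i) •
          δ^[(s (τ i)).card - 1 - u i] (∏ h ∈ s (τ i), f h)) *
        ∏ i ∈ (Finset.univ.image τ)ᶜ, δ^[(s i).card - 1] (∏ h ∈ s i, f h) := by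
  refine Finset.sum_congr rfl fun τ _ => Finset.sum_congr rfl fun s hs => ?_
  have hne : ∀ i, (s i).Nonempty := (Finset.mem_filter.1 hs).2.1
  rw [value_eq_lift]
  · rw [map_mul, map_prod, map_prod]
    simp [prodOver_eq_prod _ f (hne _)]
  · intro h
    have key : ∀ x y : WithOne R, x * y = 1 → x = 1 ∧ y = 1 := by
      intro x y hxy
      induction x using WithOne.recOneCoe with
      | one => exact ⟨rfl, by simpa using hxy⟩
      | coe a =>
        exfalso
        induction y using WithOne.recOneCoe with
        | one => rw [mul_one] at hxy; exact WithOne.coe_ne_one hxy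
        | coe b => rw [← WithOne.coe_mul] at hxy; exact WithOne.coe_ne_one hxy
    obtain ⟨h1, h2⟩ := key _ _ h
    have e1 := prod_coe_eq_one _ _ h1
    have e2 := prod_coe_eq_one _ _ h2
    have : (⟨0, by omega⟩ : Fin (N - j)) ∈ (Finset.univ.image τ)ᶜ := by
      rw [Finset.mem_compl, e1]; simp
    rw [e2] at this
    simp at this

end Unital

end DerivPartition

/-!
Write `X_A = ∑ v ∈ A, x_v` and let `∏_A` denote the product of the `f v` over `v ∈ A`. For a finite
set `V` put `H_M(V) = binom(|V| - 1, M - 1) δ ^ (|V| - M) ∏_V` (`forestTerm`). A block `A` marked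
with `u` contributes exactly `H_{u+1}(A)` to `F`, and an unmarked one contributes `H_1(A)`. The theorem
says that `F` is a numerical multiple of `H_M` of the whole set, where `M = N - j + ∑ u`.

The reason is a convolution rule (`sum_forestTerm_mul_forestTerm`): for `v ∉ W`,
`∑_{B ⊆ W} H_{p+1}({v} ∪ W \ B) H_q(B) = binom(p + q, p) H_{p+q+1}({v} ∪ W)`.
Since blocks are ordered by their minima, the first block is the one containing the least element
`v`, and removing it leaves a sum of the same kind over the union `B` of the other blocks. By
induction on the number `m` of blocks, the sum over `V` is `c(m, u) H_{m + ∑ u}(V)`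
(`sum_markedSum_blockTerm`), where `c(m + 1, u) = c(m, u) + binom(m + ∑ u, u_1) c(m, (u_2, …, u_k))`
according to whether the first block is unmarked or marked with `u_1`. Solving this recursion
(`markCount_mul`) gives the constant, visibly a natural number; if `∑ u > j` then `M > N` and
`H_M` vanishes.

The convolution rule is first proved for polynomials, with `X_A` in place of `δ` acting on `∏_A`.
There it is the coefficient of `z ^ p y ^ q` in Hurwitz's identity
`∑_{B ⊆ W} (x + z + X_{W \ B}) ^ |W \ B| · y (y + X_B) ^ (|B| - 1) = (x + z + y + X_W) ^ |W|`,
which holds because, when the first power is expanded around `x + z + y + X_W`, all coefficients but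
the leading one are finite differences of order exceeding the degree. The linear map
`∏ x_v ^ (m_v) ↦ ∏ δ^(m_v) f_v` (`symbolMap`) sends `X_A ^ a X_B ^ b` to `δ^a ∏_A · δ^b ∏_B` by the Leibniz rule, and so carries the
polynomial rule to any commutative ring with identity. A ring without identity embeds, together
with its derivation, into its unitization over `ℤ`.
-/

namespace PartitionDerivation

open Finset

/-! ### Hurwitz's identity -/

section Hurwitz

variable {α K : Type*} [DecidableEq α] [CommRing K]

/-- The alternating sum over all subsets of `W` is a `|W|`-fold finite difference, so it kills
powers of smaller degree. -/
theorem sum_powerset_neg_one_pow_mul_pow_eq_zero (x : α → K) (W : Finset α) :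
    ∀ (d : ℕ) (y : K), d < W.card →
      ∑ B ∈ W.powerset, (-1) ^ B.card * (y + ∑ b ∈ B, x b) ^ d = 0 := by
  induction W using Finset.induction_on with
  | empty => intro d y hd; simp at hd
  | insert a W ha ih =>
    intro d y hd
    rw [card_insert_of_notMem ha] at hd
    have key : ∀ B ∈ W.powerset,
        (-1) ^ B.card * (y + ∑ b ∈ B, x b) ^ d +
          (-1) ^ (insert a B).card * (y + ∑ b ∈ insert a B, x b) ^ d =
        -∑ i ∈ range d, x a ^ (d - i) * (d.choose i : K) *
          ((-1) ^ B.card * (y + ∑ b ∈ B, x b) ^ i) := by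
      intro B hB
      have haB : a ∉ B := fun h => ha (mem_powerset.1 hB h)
      rw [card_insert_of_notMem haB, sum_insert haB,
        show y + (x a + ∑ b ∈ B, x b) = (y + ∑ b ∈ B, x b) + x a by ring,
        add_pow (y + ∑ b ∈ B, x b) (x a),
        sum_range_succ, mul_add, mul_sum, ← sum_neg_distrib]
      have : ∀ i, (-1 : K) ^ (B.card + 1) * ((y + ∑ b ∈ B, x b) ^ i * x a ^ (d - i) *
          (d.choose i : K)) = -(x a ^ (d - i) * (d.choose i : K) *
          ((-1) ^ B.card * (y + ∑ b ∈ B, x b) ^ i)) := fun i => by ring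
      simp only [this, Nat.sub_self, pow_zero, Nat.choose_self, Nat.cast_one, mul_one]
      ring
    rw [sum_powerset_insert ha, ← sum_add_distrib, sum_congr rfl key, sum_neg_distrib,
      sum_comm, neg_eq_zero]
    refine sum_eq_zero fun i hi => ?_
    rw [← mul_sum, ih i y (by have := mem_range.1 hi; omega), mul_zero]

/-- The polynomial `y (y + X_B) ^ (|B| - 1)` with `X_B = ∑ b ∈ B, x b`, read as `1` for `B = ∅`. -/
def abelTerm (x : α → K) (y : K) (B : Finset α) : K :=
  if B = ∅ then 1 else y * (y + ∑ b ∈ B, x b) ^ (B.card - 1)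

/-- Hurwitz's multivariate form of Abel's binomial theorem. -/
theorem sum_pow_mul_abelTerm (x : α → K) (z y : K) (W : Finset α) :
    ∑ B ∈ W.powerset, (z + ∑ a ∈ W \ B, x a) ^ (W \ B).card * abelTerm x y B =
      (z + y + ∑ a ∈ W, x a) ^ W.card := by
  set S := z + y + ∑ a ∈ W, x a with hS
  have expand : ∀ B ∈ W.powerset,
      (z + ∑ a ∈ W \ B, x a) ^ (W \ B).card * abelTerm x y B =
      ∑ I ∈ (W \ B).powerset, S ^ I.card *
        ((-(y + ∑ b ∈ B, x b)) ^ ((W \ B).card - I.card) * abelTerm x y B) := by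
    intro B hB
    have : z + ∑ a ∈ W \ B, x a = S + -(y + ∑ b ∈ B, x b) := by
      rw [hS, ← sum_sdiff (mem_powerset.1 hB)]; ring
    rw [this, ← sum_pow_mul_eq_add_pow, sum_mul]
    exact sum_congr rfl fun I _ => by ring
  -- summing over `I` first leaves, for fixed `I`, a sum over the subsets `B` of `W \ I`
  rw [sum_congr rfl expand, sum_comm' (s' := fun I => (W \ I).powerset) (t' := W.powerset)]
  · rw [sum_eq_single_of_mem W (mem_powerset_self W)]
    · simp [abelTerm]
    · intro I hI hne
      have hIW := mem_powerset.1 hI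
      have hpos : 0 < (W \ I).card := card_pos.2 (sdiff_nonempty.2 fun h => hne (hIW.antisymm h))
      -- after factoring out `y`, what remains is a finite difference of order `|W \ I|`
      have hterm : ∀ B ∈ (W \ I).powerset, S ^ I.card *
          ((-(y + ∑ b ∈ B, x b)) ^ ((W \ B).card - I.card) * abelTerm x y B) =
          S ^ I.card * y * (-1) ^ (W \ I).card *
            ((-1) ^ B.card * (y + ∑ b ∈ B, x b) ^ ((W \ I).card - 1)) := by
        intro B hB
        have hB' := mem_powerset.1 hB
        have hBle := card_le_card hB'
        have hBW := card_sdiff_of_subset (hB'.trans sdiff_subset)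
        have hIW' := card_sdiff_of_subset hIW
        obtain ⟨e, he⟩ := Nat.exists_eq_add_of_le hBle
        have hexp : (W \ B).card - I.card = e := by omega
        have hsign : (-1 : K) ^ (W \ I).card * (-1) ^ B.card = (-1) ^ e := by
          rw [he, pow_add, mul_right_comm, ← mul_pow]; simp
        have hpow : (y + ∑ b ∈ B, x b) ^ e * abelTerm x y B =
            y * (y + ∑ b ∈ B, x b) ^ ((W \ I).card - 1) := by
          unfold abelTerm
          split_ifs with h
          · subst h
            rw [he] at hpos ⊢
            simp only [card_empty, zero_add, sum_empty, add_zero, mul_one] at hpos ⊢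
            rw [← pow_succ', Nat.sub_add_cancel hpos]
          · have := card_pos.2 (nonempty_iff_ne_empty.2 h)
            rw [he, show B.card + e - 1 = e + (B.card - 1) by omega, pow_add]
            ring
        calc _ = S ^ I.card * (-1) ^ e * ((y + ∑ b ∈ B, x b) ^ e * abelTerm x y B) := by
              rw [hexp, neg_pow]; ring
          _ = _ := by rw [hpow, ← hsign]; ring
      rw [sum_congr rfl hterm, ← mul_sum,
        sum_powerset_neg_one_pow_mul_pow_eq_zero x (W \ I) _ y (by omega), mul_zero]
  · intro B I
    simp only [mem_powerset, subset_sdiff]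
    constructor
    · rintro ⟨h1, h2, h3⟩; exact ⟨⟨h1, h3.symm⟩, h2⟩
    · rintro ⟨⟨h1, h3⟩, h2⟩; exact ⟨h1, h2, h3.symm⟩

/-- The number of compositions of `n` into `M` positive parts: `binom(n - 1, M - 1)`, with the
values at `n = 0` and `M = 0` that make the convolution rules hold without exceptions. -/
def compCount : ℕ → ℕ → ℕ
  | 0, 0 => 1
  | 0, _ + 1 => 0
  | _ + 1, 0 => 0
  | n + 1, M + 1 => n.choose M

open Polynomial in
/-- The coefficient of `y ^ q` in `y (y + X_B) ^ (|B| - 1)`. -/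
theorem coeff_abelTerm (x : α → K) (B : Finset α) (q : ℕ) :
    (abelTerm (fun a => C (x a)) X B).coeff q =
      compCount B.card q * (∑ b ∈ B, x b) ^ (B.card - q) := by
  unfold abelTerm
  split_ifs with h
  · subst h
    cases q <;> simp [compCount, coeff_one]
  · obtain ⟨n, hn⟩ := Nat.exists_eq_succ_of_ne_zero (card_ne_zero.2 (nonempty_iff_ne_empty.2 h))
    rw [hn, ← map_sum]
    cases q with
    | zero => simp [compCount]
    | succ q =>
      rw [coeff_X_mul, Nat.succ_sub_one, coeff_X_add_C_pow, Nat.succ_sub_succ, mul_comm]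
      rfl

open Polynomial in
/-- The coefficient of `z ^ p * y ^ q` in Hurwitz's identity at `z + w`. -/
theorem sum_choose_mul_compCount (x : α → K) (w : K) (W : Finset α) (p q : ℕ) :
    ∑ B ∈ W.powerset, ((W \ B).card.choose p : K) *
        (w + ∑ a ∈ W \ B, x a) ^ ((W \ B).card - p) *
        (compCount B.card q * (∑ b ∈ B, x b) ^ (B.card - q)) =
      ((p + q).choose p * W.card.choose (p + q) : ℕ) *
        (w + ∑ a ∈ W, x a) ^ (W.card - (p + q)) := by
  have h := congrArg (fun P : K[X][X] => (P.coeff q).coeff p)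
    (sum_pow_mul_abelTerm (fun a => C (C (x a))) (C (X + C w)) X W)
  simp only [finsetSum_coeff] at h
  have hL : ∀ B ∈ W.powerset, (((C (X + C w) + ∑ a ∈ W \ B, C (C (x a))) ^ (W \ B).card *
      abelTerm (fun a => C (C (x a))) X B : K[X][X]).coeff q).coeff p =
      ((W \ B).card.choose p : K) *
        (w + ∑ a ∈ W \ B, x a) ^ ((W \ B).card - p) *
        (compCount B.card q * (∑ b ∈ B, x b) ^ (B.card - q)) := by
    intro B _
    rw [← map_sum, ← map_add, ← map_pow, coeff_C_mul, coeff_abelTerm (fun a => C (x a)),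
      ← map_sum, ← map_sum, add_assoc, ← map_add, ← map_pow, ← C_eq_natCast, ← map_mul,
      coeff_mul_C, coeff_X_add_C_pow]
    ring
  rw [sum_congr rfl hL] at h
  rw [h, ← map_sum, add_right_comm, ← map_add, add_comm, coeff_X_add_C_pow, ← map_sum,
    add_assoc, ← map_add, ← C_eq_natCast, coeff_mul_C, coeff_X_add_C_pow]
  have hc : (W.card.choose q : K) * ((W.card - q).choose p : K) =
      ((p + q).choose p * W.card.choose (p + q) : ℕ) := by
    rw [← Nat.cast_mul]
    congr 1
    have := Nat.choose_mul (n := W.card) (Nat.le_add_left q p)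
    rw [Nat.add_sub_cancel, ← Nat.choose_symm_add] at this
    rw [← this, mul_comm]
  rw [← hc, Nat.sub_sub, add_comm q p]
  ring

end Hurwitz

/-! ### From polynomials to derivations -/

section Transfer

variable {α R : Type*} [CommRing R]

theorem iterate_sum (δ : R →+ R) {ι : Type*} (A : Finset ι) (g : ι → R) (n : ℕ) :
    δ^[n] (∑ i ∈ A, g i) = ∑ i ∈ A, δ^[n] (g i) := by
  induction n with
  | zero => rfl
  | succ n ih => simp only [Function.iterate_succ_apply', ih, map_sum]

theorem derivation_one (δ : R →+ R) (hδ : ∀ a b : R, δ (a * b) = a * δ b + δ a * b) :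
    δ 1 = 0 := by
  simpa using hδ 1 1

/-- The Leibniz rule for a product over `A`: the summands differentiate one factor each. -/
theorem derivation_prod [DecidableEq α] (δ : R →+ R) (hδ : ∀ a b : R, δ (a * b) = a * δ b + δ a * b)
    (A : Finset α) (f : α → R) :
    δ (∏ a ∈ A, f a) = ∑ v ∈ A, ∏ a ∈ A, Function.update f v (δ (f v)) a := by
  induction A using Finset.induction_on with
  | empty => simpa using derivation_one δ hδ
  | insert b A hb ih =>
    rw [prod_insert hb, hδ, ih, sum_insert hb, prod_insert hb, Function.update_self,
      prod_update_of_notMem hb, add_comm, mul_sum]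
    congr 1
    refine sum_congr rfl fun v hv => ?_
    rw [prod_insert hb, Function.update_of_ne (ne_of_mem_of_not_mem hv hb).symm]

/-- The `ℤ`-linear map from polynomials to `R` that sends the monomial `∏ v, X v ^ m v` to
`∏ v ∈ V, δ^[m v] (f v)`: the variable `X v` acts as `δ` on the factor with index `v`. -/
noncomputable def symbolMap (δ : R →+ R) (V : Finset α) (f : α → R) :
    MvPolynomial α ℤ →ₗ[ℤ] R :=
  (MvPolynomial.basisMonomials α ℤ).constr ℤ fun m => ∏ v ∈ V, δ^[m v] (f v)

theorem symbolMap_monomial (δ : R →+ R) (V : Finset α) (f : α → R) (m : α →₀ ℕ) :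
    symbolMap δ V f (MvPolynomial.monomial m 1) = ∏ v ∈ V, δ^[m v] (f v) := by
  have := (MvPolynomial.basisMonomials α ℤ).constr_basis ℤ (fun m => ∏ v ∈ V, δ^[m v] (f v)) m
  rwa [MvPolynomial.coe_basisMonomials] at this

theorem symbolMap_X_mul [DecidableEq α] (δ : R →+ R) (V : Finset α) (f : α → R) (v : α)
    (P : MvPolynomial α ℤ) :
    symbolMap δ V f (MvPolynomial.X v * P) =
      symbolMap δ V (Function.update f v (δ (f v))) P := by
  have h : symbolMap δ V f ∘ₗ LinearMap.mulLeft ℤ (MvPolynomial.X v) =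
      symbolMap δ V (Function.update f v (δ (f v))) := by
    refine (MvPolynomial.basisMonomials α ℤ).ext fun m => ?_
    simp only [MvPolynomial.coe_basisMonomials, LinearMap.comp_apply, LinearMap.mulLeft_apply]
    rw [MvPolynomial.X, MvPolynomial.monomial_mul, one_mul, symbolMap_monomial,
      symbolMap_monomial]
    refine prod_congr rfl fun w _ => ?_
    by_cases hw : w = v
    · subst hw
      rw [Function.update_self, ← Function.iterate_succ_apply]
      simp [add_comm]
    · rw [Function.update_of_ne hw]
      simp [Ne.symm hw]
  exact LinearMap.congr_fun h P

/-- Under `symbolMap`, multiplication by `∑ v ∈ A, X v` is differentiation of the product over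
`A`, by the Leibniz rule. -/
theorem symbolMap_pow_mul_pow [DecidableEq α] (δ : R →+ R)
    (hδ : ∀ a b : R, δ (a * b) = a * δ b + δ a * b)
    (A B : Finset α) (hAB : Disjoint A B) (a b : ℕ) (f : α → R) :
    symbolMap δ (A ∪ B) f ((∑ v ∈ A, MvPolynomial.X v) ^ a * (∑ v ∈ B, MvPolynomial.X v) ^ b) =
      δ^[a] (∏ v ∈ A, f v) * δ^[b] (∏ v ∈ B, f v) := by
  induction a generalizing f with
  | zero =>
    induction b generalizing f with
    | zero =>
      have := symbolMap_monomial δ (A ∪ B) f 0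
      rw [MvPolynomial.monomial_zero', map_one] at this
      simpa [prod_union hAB] using this
    | succ b ih =>
      rw [pow_succ', mul_left_comm, sum_mul, map_sum, Function.iterate_succ_apply,
        derivation_prod δ hδ, iterate_sum, mul_sum]
      refine sum_congr rfl fun v hv => ?_
      rw [symbolMap_X_mul, ih, prod_update_of_notMem (disjoint_right.1 hAB hv)]
  | succ a ih =>
    rw [pow_succ', mul_assoc, sum_mul, map_sum, Function.iterate_succ_apply,
      derivation_prod δ hδ, iterate_sum, sum_mul]
    refine sum_congr rfl fun v hv => ?_
    rw [symbolMap_X_mul, ih, prod_update_of_notMem (disjoint_left.1 hAB hv)]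

/-- The element `binom(|V| - 1, M - 1) δ ^ (|V| - M) ∏ v ∈ V, f v`. It is the common value, up to
a numerical factor, of all sums over partitions of `V` whose total derivative has order
`|V| - M`. -/
def forestTerm (δ : R →+ R) (f : α → R) (V : Finset α) (M : ℕ) : R :=
  compCount V.card M • δ^[V.card - M] (∏ v ∈ V, f v)

/-- The convolution rule for `forestTerm` over the splittings of a set with the point `v` kept in
the first part. -/
theorem sum_forestTerm_mul_forestTerm [DecidableEq α] (δ : R →+ R)
    (hδ : ∀ a b : R, δ (a * b) = a * δ b + δ a * b) (f : α → R) (v : α) (W : Finset α)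
    (hv : v ∉ W) (p q : ℕ) :
    ∑ B ∈ W.powerset, forestTerm δ f (insert v (W \ B)) (p + 1) * forestTerm δ f B q =
      (p + q).choose p • forestTerm δ f (insert v W) (p + q + 1) := by
  have h := congrArg (symbolMap δ (insert v W) f)
    (sum_choose_mul_compCount (K := MvPolynomial α ℤ) MvPolynomial.X (MvPolynomial.X v) W p q)
  rw [map_sum] at h
  have hR := symbolMap_pow_mul_pow δ hδ (insert v W) ∅ (disjoint_empty_right _)
    (W.card - (p + q)) 0 f
  simp only [union_empty, pow_zero, mul_one, prod_empty, Function.iterate_zero, id_eq] at hR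
  rw [← nsmul_eq_mul, map_nsmul, ← sum_insert hv, hR] at h
  rw [forestTerm, card_insert_of_notMem hv, Nat.add_sub_add_right, smul_smul]
  refine Eq.trans (sum_congr rfl fun B hB => ?_) h
  have hBW := mem_powerset.1 hB
  have hvB : v ∉ W \ B := fun h => hv (sdiff_subset h)
  have hdisj : Disjoint (insert v (W \ B)) B :=
    disjoint_insert_left.2 ⟨fun h => hv (hBW h), sdiff_disjoint⟩
  have hU : insert v (W \ B) ∪ B = insert v W := by
    rw [insert_union, sdiff_union_of_subset hBW]
  have h2 := symbolMap_pow_mul_pow δ hδ _ _ hdisj ((W \ B).card - p) (B.card - q) f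
  rw [hU, sum_insert hvB] at h2
  rw [forestTerm, forestTerm, card_insert_of_notMem hvB, Nat.add_sub_add_right,
    smul_mul_smul_comm, ← h2, ← map_nsmul]
  congr 1
  rw [nsmul_eq_mul, Nat.cast_mul]
  simp only [compCount]
  ring

end Transfer

/-! ### Marked ordered partitions -/

section Markings

variable {R : Type*} [CommRing R]

/-- The sum over all increasing `τ : Fin k → Fin m` of the products of the `a (τ i) (u i)` and of
the `a i 0` for the indices `i` outside the image of `τ`. -/
def markedSum {m k : ℕ} (a : Fin m → ℕ → R) (u : Fin k → ℕ) : R :=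
  ∑ τ ∈ DerivPartition.markings m k,
    (∏ i, a (τ i) (u i)) * ∏ i ∈ (univ.image τ)ᶜ, a i 0

theorem mem_markings {m k : ℕ} {τ : Fin k → Fin m} :
    τ ∈ DerivPartition.markings m k ↔ StrictMono τ := by
  simp [DerivPartition.markings, StrictMono]

theorem markedSum_of_isEmpty {m : ℕ} (a : Fin m → ℕ → R) (u : Fin 0 → ℕ) :
    markedSum a u = ∏ i, a i 0 := by
  have : DerivPartition.markings m 0 = univ :=
    eq_univ_of_forall fun τ => mem_markings.2 (Subsingleton.strictMono τ)
  rw [markedSum, this]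
  simp

theorem markedSum_fin_zero {k : ℕ} (a : Fin 0 → ℕ → R) (u : Fin (k + 1) → ℕ) :
    markedSum a u = 0 :=
  sum_eq_zero fun τ _ => (τ 0).elim0

theorem strictMono_succ_comp {m k : ℕ} {τ : Fin k → Fin m} :
    StrictMono (fun i => (τ i).succ) ↔ StrictMono τ := by
  simp [StrictMono]

theorem strictMono_cons_zero {m k : ℕ} {τ : Fin k → Fin m} :
    StrictMono (Fin.cons 0 (fun i => (τ i).succ) : Fin (k + 1) → Fin (m + 1)) ↔
      StrictMono τ := by
  constructor
  · intro h a b hab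
    simpa using h (Fin.succ_lt_succ_iff.2 hab)
  · intro h a b hab
    induction a using Fin.cases with
    | zero =>
      induction b using Fin.cases with
      | zero => exact absurd hab (lt_irrefl _)
      | succ b => simp
    | succ a =>
      induction b using Fin.cases with
      | zero => exact absurd hab (Fin.not_lt_zero _)
      | succ b => simpa using h (Fin.succ_lt_succ_iff.1 hab)

/-- The increasing functions into `Fin (m + 1)` are those that avoid `0` and those that start
with `0`. -/
theorem markings_succ_succ (m k : ℕ) :
    DerivPartition.markings (m + 1) (k + 1) =
      (DerivPartition.markings m (k + 1)).image (fun τ i => (τ i).succ) ∪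
      (DerivPartition.markings m k).image (fun τ => Fin.cons 0 fun i => (τ i).succ) := by
  ext τ
  simp only [mem_union, mem_image, mem_markings]
  constructor
  · intro h
    have hpos : ∀ i : Fin k, τ i.succ ≠ 0 := fun i =>
      ((Fin.zero_le _).trans_lt (h (Fin.succ_pos i))).ne'
    by_cases h0 : τ 0 = 0
    · right
      have he : (Fin.cons 0 fun i => ((τ (Fin.succ i)).pred (hpos i)).succ) = τ := by
        funext i
        induction i using Fin.cases with
        | zero => simp [h0]
        | succ i => simp
      exact ⟨fun i => (τ i.succ).pred (hpos i), strictMono_cons_zero.1 (by rwa [he]), he⟩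
    · left
      have hne : ∀ i, τ i ≠ 0 := fun i => by
        induction i using Fin.cases with
        | zero => exact h0
        | succ i => exact hpos i
      have he : (fun i => ((τ i).pred (hne i)).succ) = τ := by
        funext i; simp
      exact ⟨fun i => (τ i).pred (hne i), strictMono_succ_comp.1 (by rwa [he]), he⟩
  · rintro (⟨τ, h, rfl⟩ | ⟨τ, h, rfl⟩)
    · exact strictMono_succ_comp.2 h
    · exact strictMono_cons_zero.2 h

theorem prod_compl_image_succ {m k : ℕ} (τ : Fin k → Fin m) (g : Fin (m + 1) → R) :
    ∏ i ∈ (univ.image fun i => (τ i).succ)ᶜ, g i =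
      g 0 * ∏ i ∈ (univ.image τ)ᶜ, g i.succ := by
  have : (univ.image fun i => (τ i).succ)ᶜ =
      insert 0 ((univ.image τ)ᶜ.image Fin.succ) := by
    ext i
    induction i using Fin.cases <;> simp [Fin.succ_ne_zero, eq_comm]
  rw [this, prod_insert (by simp [Fin.succ_ne_zero]), prod_image (Fin.succ_injective _).injOn]

theorem prod_compl_image_cons {m k : ℕ} (τ : Fin k → Fin m) (g : Fin (m + 1) → R) :
    ∏ i ∈ (univ.image (Fin.cons 0 (fun i => (τ i).succ) : Fin (k + 1) → Fin (m + 1)))ᶜ, g i =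
      ∏ i ∈ (univ.image τ)ᶜ, g i.succ := by
  have : (univ.image (Fin.cons 0 (fun i => (τ i).succ) : Fin (k + 1) → Fin (m + 1)))ᶜ =
      (univ.image τ)ᶜ.image Fin.succ := by
    ext i
    induction i using Fin.cases <;> simp [Fin.exists_fin_succ, Fin.succ_ne_zero, eq_comm]
  rw [this, prod_image (Fin.succ_injective _).injOn]

theorem markedSum_succ_succ {m k : ℕ} (a : Fin (m + 1) → ℕ → R) (u : Fin (k + 1) → ℕ) :
    markedSum a u = a 0 0 * markedSum (fun i => a i.succ) u +
      a 0 (u 0) * markedSum (fun i => a i.succ) (fun i => u i.succ) := by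
  rw [markedSum, markings_succ_succ, sum_union, sum_image, sum_image, markedSum, markedSum,
    mul_sum, mul_sum]
  · congr 1
    · refine sum_congr rfl fun τ _ => ?_
      rw [prod_compl_image_succ]
      ring
    · refine sum_congr rfl fun τ _ => ?_
      rw [prod_compl_image_cons, Fin.prod_univ_succ]
      simp only [Fin.cons_zero, Fin.cons_succ]
      ring
  · intro τ _ τ' _ h
    funext i
    simpa using congrFun h i.succ
  · intro τ _ τ' _ h
    funext i
    simpa using congrFun h i
  · rw [disjoint_left]
    rintro _ h h'
    obtain ⟨τ, _, rfl⟩ := mem_image.1 h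
    obtain ⟨τ', _, h⟩ := mem_image.1 h'
    exact Fin.succ_ne_zero _ (congrFun h 0).symm

end Markings

section Partitions

variable {α : Type*} [LinearOrder α] [Fintype α]

/-- The partitions of `V` into `m` blocks, listed in increasing order of their minima. -/
def orderedPartitions (V : Finset α) (m : ℕ) : Finset (Fin m → Finset α) :=
  univ.filter fun s =>
    (∀ i, (s i).Nonempty) ∧ (∀ i i', i ≠ i' → Disjoint (s i) (s i')) ∧
    univ.biUnion s = V ∧ (∀ i i', i < i' → (s i).min < (s i').min)

theorem setPartitions_eq (N m : ℕ) :
    DerivPartition.setPartitions N m = orderedPartitions univ m := by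
  ext s
  simp [DerivPartition.setPartitions, orderedPartitions]

theorem sum_orderedPartitions_zero {M : Type*} [AddCommMonoid M] (V : Finset α)
    (g : (Fin 0 → Finset α) → M) (c : M) (hc : ∀ s, g s = c) :
    ∑ s ∈ orderedPartitions V 0, g s = if V = ∅ then c else 0 := by
  simp only [hc, sum_const]
  split_ifs with h <;> simp [orderedPartitions, h, eq_comm]

theorem orderedPartitions_empty_succ (m : ℕ) :
    orderedPartitions (∅ : Finset α) (m + 1) = ∅ := by
  refine eq_empty_of_forall_notMem fun s hs => ?_
  obtain ⟨h1, -, h3, -⟩ := (mem_filter.1 hs).2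
  obtain ⟨x, hx⟩ := h1 0
  exact notMem_empty x (h3 ▸ mem_biUnion.2 ⟨0, mem_univ _, hx⟩)

theorem forall_mem_lt_min {α : Type*} [LinearOrder α] {v : α} {A : Finset α} (h : ∀ w ∈ A, v < w) :
    (v : WithTop α) < A.min := by
  rcases A.eq_empty_or_nonempty with rfl | hA
  · simp
  · rw [← coe_min' hA]
    exact_mod_cast h _ (min'_mem A hA)

theorem cons_mem_orderedPartitions {v : α} {W B : Finset α} {m : ℕ} (hv : ∀ w ∈ W, v < w)
    (hB : B ⊆ W) {s : Fin m → Finset α} (hs : s ∈ orderedPartitions B m) :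
    (Fin.cons (insert v (W \ B)) s : Fin (m + 1) → Finset α) ∈
      orderedPartitions (insert v W) (m + 1) := by
  obtain ⟨h1, h2, h3, h4⟩ := (mem_filter.1 hs).2
  have hvW : v ∉ W := fun h => lt_irrefl v (hv v h)
  have hsub : ∀ i, s i ⊆ B := fun i => h3 ▸ subset_biUnion_of_mem s (mem_univ i)
  have hd : ∀ i, Disjoint (insert v (W \ B)) (s i) := fun i =>
    disjoint_insert_left.2 ⟨fun h => hvW (hB (hsub i h)),
      disjoint_of_subset_right (hsub i) sdiff_disjoint⟩
  refine mem_filter.2 ⟨mem_univ _, ?_, ?_, ?_, ?_⟩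
  · intro i
    induction i using Fin.cases <;> simp [h1]
  · intro i i' hne
    induction i using Fin.cases <;> induction i' using Fin.cases
    · exact absurd rfl hne
    · simpa using hd _
    · simpa using (hd _).symm
    · simpa using h2 _ _ fun h => hne (congrArg _ h)
  · have : univ.biUnion (Fin.cons (insert v (W \ B)) s : Fin (m + 1) → Finset α) =
        insert v (W \ B) ∪ univ.biUnion s := by
      ext x; simp [Fin.exists_fin_succ, or_assoc]
    rw [this, h3, insert_union, sdiff_union_of_subset hB]
  · intro i i' hlt
    induction i' using Fin.cases with
    | zero => exact absurd hlt (Fin.not_lt_zero _)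
    | succ i' =>
      induction i using Fin.cases with
      | zero =>
        exact (min_le (mem_insert_self _ _)).trans_lt
          (forall_mem_lt_min fun w hw => hv w (hB (hsub i' hw)))
      | succ i => simpa using h4 i i' (Fin.succ_lt_succ_iff.1 hlt)

theorem exists_cons_eq {v : α} {W : Finset α} {m : ℕ} (hv : ∀ w ∈ W, v < w)
    {s : Fin (m + 1) → Finset α} (hs : s ∈ orderedPartitions (insert v W) (m + 1)) :
    ∃ B ⊆ W, insert v (W \ B) = s 0 ∧ (fun i => s i.succ) ∈ orderedPartitions B m := by
  obtain ⟨h1, h2, h3, h4⟩ := (mem_filter.1 hs).2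
  have hsub : ∀ i, s i ⊆ insert v W := fun i => h3 ▸ subset_biUnion_of_mem s (mem_univ i)
  have hv0 : v ∈ s 0 := by
    obtain ⟨i, -, hi⟩ := mem_biUnion.1 (h3.symm ▸ mem_insert_self v W : v ∈ univ.biUnion s)
    induction i using Fin.cases with
    | zero => exact hi
    | succ i =>
      exfalso
      have h5 := (h4 0 i.succ (Fin.succ_pos i)).trans_le (min_le hi)
      rw [← coe_min' (h1 0)] at h5
      have h6 : (s 0).min' (h1 0) < v := by exact_mod_cast h5
      rcases mem_insert.1 (hsub 0 (min'_mem _ (h1 0))) with h7 | h7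
      · exact h6.ne h7
      · exact lt_asymm h6 (hv _ h7)
  have hvs : ∀ i : Fin m, v ∉ s i.succ := fun i h =>
    disjoint_left.1 (h2 0 i.succ (Fin.succ_ne_zero i).symm) hv0 h
  refine ⟨univ.biUnion fun i : Fin m => s i.succ, ?_, ?_, ?_⟩
  · intro x hx
    obtain ⟨i, -, hi⟩ := mem_biUnion.1 hx
    exact (mem_insert.1 (hsub _ hi)).resolve_left fun h => hvs i (h ▸ hi)
  · ext x
    simp only [mem_insert, mem_sdiff, mem_biUnion, mem_univ, true_and, not_exists]
    constructor
    · rintro (rfl | ⟨hx, hx'⟩)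
      · exact hv0
      · obtain ⟨i, -, hi⟩ := mem_biUnion.1 (h3.symm ▸ mem_insert_of_mem hx : x ∈ univ.biUnion s)
        induction i using Fin.cases with
        | zero => exact hi
        | succ i => exact absurd hi (hx' i)
    · intro hx
      rcases mem_insert.1 (hsub 0 hx) with h | h
      · exact Or.inl h
      · exact Or.inr ⟨h, fun i hi => disjoint_left.1 (h2 0 i.succ (Fin.succ_ne_zero i).symm) hx hi⟩
  · exact mem_filter.2 ⟨mem_univ _, fun i => h1 _,
      fun i i' h => h2 _ _ fun h' => h (Fin.succ_injective _ h'), rfl,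
      fun i i' h => h4 _ _ (Fin.succ_lt_succ_iff.2 h)⟩

/-- Removing the first block, which contains the minimum `v`, from an ordered partition leaves an
ordered partition of the union `B` of the other blocks. -/
theorem sum_orderedPartitions_insert {M : Type*} [AddCommMonoid M] {v : α} {W : Finset α}
    (m : ℕ) (hv : ∀ w ∈ W, v < w) (g : (Fin (m + 1) → Finset α) → M) :
    ∑ s ∈ orderedPartitions (insert v W) (m + 1), g s =
      ∑ B ∈ W.powerset, ∑ s ∈ orderedPartitions B m, g (Fin.cons (insert v (W \ B)) s) := by
  symm
  rw [sum_sigma']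
  refine sum_bij (fun x _ => Fin.cons (insert v (W \ x.1)) x.2) ?_ ?_ ?_ ?_
  · rintro ⟨B, s⟩ h
    obtain ⟨hB, hs⟩ := mem_sigma.1 h
    exact cons_mem_orderedPartitions hv (mem_powerset.1 hB) hs
  · rintro ⟨B, s⟩ h ⟨B', s'⟩ h' he
    obtain ⟨-, hs⟩ := mem_sigma.1 h
    obtain ⟨-, hs'⟩ := mem_sigma.1 h'
    obtain rfl : s = s' := funext fun i => by simpa using congrFun he i.succ
    obtain rfl : B = B' :=
      ((mem_filter.1 hs).2.2.2.1).symm.trans (mem_filter.1 hs').2.2.2.1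
    rfl
  · intro s hs
    obtain ⟨B, hB, h0, hs'⟩ := exists_cons_eq hv hs
    refine ⟨⟨B, fun i => s i.succ⟩, mem_sigma.2 ⟨mem_powerset.2 hB, hs'⟩, ?_⟩
    funext i
    induction i using Fin.cases <;> simp [h0]
  · intros; rfl

end Partitions

/-! ### Evaluation of the sum over marked partitions -/

section Evaluation

/-- The numerical factor contributed by `k` marks with orders `u` on `m` blocks. The two summands
of the recursion correspond to the first block being unmarked and marked with `u 0`. -/
def markCount : (m k : ℕ) → (Fin k → ℕ) → ℕ
  | _, 0, _ => 1
  | 0, _ + 1, _ => 0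
  | m + 1, k + 1, u => markCount m (k + 1) u +
      (m + ∑ i, u i).choose (u 0) * markCount m k fun i => u i.succ

theorem markCount_of_isEmpty (m : ℕ) (u : Fin 0 → ℕ) : markCount m 0 u = 1 := by
  cases m <;> rfl

theorem markCount_eq_zero (m : ℕ) : ∀ (k : ℕ) (u : Fin k → ℕ), m < k → markCount m k u = 0 := by
  induction m with
  | zero =>
    intro k u hk
    obtain ⟨k, rfl⟩ := Nat.exists_eq_succ_of_ne_zero hk.ne'
    rfl
  | succ m ih =>
    intro k u hk
    obtain ⟨k, rfl⟩ := Nat.exists_eq_succ_of_ne_zero (Nat.ne_zero_of_lt hk)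
    rw [markCount, ih _ _ (by omega), ih _ _ (by omega), mul_zero, add_zero]

/-- Removing `u 0` from the product in the denominator of `DerivPartition.C` removes exactly its
first factor. -/
theorem prod_hook_succ {k : ℕ} (u : Fin (k + 1) → ℕ) :
    ∏ i : Fin (k + 1), (k + 1 - (i : ℕ) + ∑ g ∈ Ici i, u g) =
      (k + 1 + ∑ i, u i) * ∏ i : Fin k, (k - (i : ℕ) + ∑ g ∈ Ici i, u g.succ) := by
  rw [Fin.prod_univ_succ]
  congr 1
  · have : Ici (0 : Fin (k + 1)) = univ := by ext; simp
    rw [this]; simp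
  · refine prod_congr rfl fun i _ => ?_
    have : Ici i.succ = (Ici i).map (Fin.succEmb k) := by
      ext x
      induction x using Fin.cases <;> simp [Fin.succ_ne_zero]
    rw [this, sum_map]
    simp

/-- The closed form of `markCount`, cleared of denominators. In the recursion from `(m, k)` to
`(m + 1, k + 1)` the two summands contribute `(m - k) (m + ∑ u)!` and `(k + 1 + ∑ u) (m + ∑ u)!`. -/
theorem markCount_mul (m : ℕ) : ∀ (k : ℕ) (u : Fin k → ℕ), k ≤ m →
    markCount m k u * ((m - k).factorial * (∏ i, (u i).factorial) *
      ∏ i : Fin k, (k - (i : ℕ) + ∑ g ∈ Ici i, u g)) = (m + ∑ i, u i).factorial := by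
  induction m with
  | zero =>
    intro k u hk
    obtain rfl := Nat.le_zero.1 hk
    simp [markCount]
  | succ m ih =>
    intro k u hk
    cases k with
    | zero => simp [markCount]
    | succ k =>
      have hkm : k ≤ m := by omega
      have h2 := ih k (fun i => u i.succ) hkm
      have h1 : markCount m (k + 1) u * ((m - k).factorial * (∏ i, (u i).factorial) *
          ∏ i : Fin (k + 1), (k + 1 - (i : ℕ) + ∑ g ∈ Ici i, u g)) =
          (m - k) * (m + ∑ i, u i).factorial := by
        rcases hkm.eq_or_lt with rfl | hlt
        · rw [markCount_eq_zero _ _ _ (Nat.lt_succ_self _)]; simp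
        · rw [← ih (k + 1) u hlt, show m - k = (m - (k + 1)) + 1 by omega, Nat.factorial_succ]
          ring
      have h3 : (m + ∑ i, u i).choose (u 0) * (u 0).factorial *
          (m + ∑ i : Fin k, u i.succ).factorial = (m + ∑ i, u i).factorial := by
        rw [← Nat.choose_mul_factorial_mul_factorial
          (show u 0 ≤ m + ∑ i, u i by rw [Fin.sum_univ_succ]; omega)]
        congr 2
        rw [Fin.sum_univ_succ]; omega
      rw [markCount, add_mul, Nat.succ_sub_succ, h1, prod_hook_succ, Fin.prod_univ_succ]
      -- `m = k + d` turns the remaining identity into `d + (k + 1 + ∑ u) = m + 1 + ∑ u`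
      obtain ⟨d, rfl⟩ := Nat.exists_eq_add_of_le hkm
      rw [show k + d + 1 + ∑ i, u i = (k + d + ∑ i, u i) + 1 by ring, Nat.factorial_succ]
      simp only [Nat.add_sub_cancel_left] at h2 ⊢
      rw [show ∀ a b c d e f g : ℕ, a * b * (c * (d * e) * (f * g)) =
        f * (a * d * (b * (c * e * g))) from fun _ _ _ _ _ _ _ => by ring, h2, h3]
      ring

variable {α R : Type*} [CommRing R]

/-- The factor of a block `A` marked with `n`; unmarked blocks have `n = 0`. -/
def blockTerm (δ : R →+ R) (f : α → R) (A : Finset α) (n : ℕ) : R :=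
  (A.card - 1).choose n • δ^[A.card - 1 - n] (∏ h ∈ A, f h)

theorem blockTerm_insert [DecidableEq α] (δ : R →+ R) (f : α → R) {v : α} {A : Finset α}
    (hv : v ∉ A) (n : ℕ) :
    blockTerm δ f (insert v A) n = forestTerm δ f (insert v A) (n + 1) := by
  rw [blockTerm, forestTerm, card_insert_of_notMem hv, Nat.add_sub_cancel,
    Nat.add_sub_add_right]
  rfl

/-- The sum over marked partitions of `V` into `m` blocks depends on `V` only through
`forestTerm`. Splitting off the first block turns the induction step into the convolution rule. -/
theorem sum_markedSum_blockTerm [LinearOrder α] [Fintype α] (δ : R →+ R)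
    (hδ : ∀ a b : R, δ (a * b) = a * δ b + δ a * b) (f : α → R) (m : ℕ) :
    ∀ (V : Finset α) (k : ℕ) (u : Fin k → ℕ),
      ∑ s ∈ orderedPartitions V m, markedSum (fun i => blockTerm δ f (s i)) u =
        markCount m k u • forestTerm δ f V (m + ∑ i, u i) := by
  induction m with
  | zero =>
    intro V k u
    cases k with
    | zero =>
      rw [sum_orderedPartitions_zero V _ 1 fun s => by simp [markedSum_of_isEmpty]]
      split_ifs with h
      · subst h; simp [markCount, forestTerm, compCount]
      · obtain ⟨n, hn⟩ :=
          Nat.exists_eq_succ_of_ne_zero (card_ne_zero.2 (nonempty_iff_ne_empty.2 h))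
        simp [markCount, forestTerm, hn, compCount]
    | succ k => simp [markedSum_fin_zero, markCount]
  | succ m ih =>
    intro V k u
    rcases V.eq_empty_or_nonempty with rfl | hV
    · rw [orderedPartitions_empty_succ, sum_empty, forestTerm, card_empty, Nat.add_right_comm]
      simp [compCount]
    · -- `v` is the least element of `V`, hence lies in the first block, and `W = V \ {v}`
      have hmem := min'_mem V hV
      have hlt : ∀ w ∈ V.erase (V.min' hV), V.min' hV < w := fun w hw =>
        min'_lt_of_mem_erase_min' V hV hw
      have hnot : V.min' hV ∉ V.erase (V.min' hV) := notMem_erase _ _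
      rw [← insert_erase hmem]
      generalize V.erase (V.min' hV) = W at hlt hnot
      generalize V.min' hV = v at hlt hnot
      have hblock : ∀ (B : Finset α) (n : ℕ), blockTerm δ f (insert v (W \ B)) n =
          forestTerm δ f (insert v (W \ B)) (n + 1) := fun B n =>
        blockTerm_insert δ f (fun h => hnot (sdiff_subset h)) n
      rw [sum_orderedPartitions_insert m hlt]
      cases k with
      | zero =>
        have := sum_forestTerm_mul_forestTerm δ hδ f v W hnot 0 m
        simp only [Nat.choose_zero_right, one_smul, zero_add] at this
        simp only [markCount, one_smul, univ_eq_empty, sum_empty, add_zero]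
        rw [← this]
        refine sum_congr rfl fun B _ => ?_
        have hB := ih B 0 u
        rw [markCount_of_isEmpty, one_smul] at hB
        simp only [univ_eq_empty, sum_empty, add_zero] at hB
        have h10 : forestTerm δ f (insert v (W \ B)) 1 = blockTerm δ f (insert v (W \ B)) 0 :=
          (hblock B 0).symm
        rw [← hB, mul_sum, h10]
        refine sum_congr rfl fun s _ => ?_
        simp only [markedSum_of_isEmpty, Fin.prod_univ_succ, Fin.cons_zero, Fin.cons_succ]
      | succ k =>
        have h0 := sum_forestTerm_mul_forestTerm δ hδ f v W hnot 0 (m + ∑ i, u i)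
        have h1 := sum_forestTerm_mul_forestTerm δ hδ f v W hnot (u 0) (m + ∑ i : Fin k, u i.succ)
        rw [show u 0 + (m + ∑ i : Fin k, u i.succ) = m + ∑ i, u i by
          rw [Fin.sum_univ_succ]; ring] at h1
        simp only [Nat.choose_zero_right, one_smul, zero_add] at h0
        rw [markCount, Nat.add_right_comm, add_smul, mul_comm, mul_smul, ← h1, ← h0, smul_sum,
          smul_sum, ← sum_add_distrib]
        refine sum_congr rfl fun B _ => ?_
        rw [← mul_smul_comm, ← mul_smul_comm, ← ih, ← ih, mul_sum, mul_sum, ← sum_add_distrib]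
        refine sum_congr rfl fun s _ => ?_
        rw [markedSum_succ_succ]
        simp only [Fin.cons_zero, Fin.cons_succ, hblock, zero_add]

end Evaluation

/-! ### The constant -/

section Constant

theorem compCount_eq_zero {n M : ℕ} (h : n < M) : compCount n M = 0 := by
  obtain ⟨M, rfl⟩ := Nat.exists_eq_succ_of_ne_zero (Nat.ne_zero_of_lt h)
  cases n with
  | zero => rfl
  | succ n => exact Nat.choose_eq_zero_of_lt (by omega)

theorem markCount_mul_compCount (N j k : ℕ) (hj : j < N) (hk : k ≤ N - j) (u : Fin k → ℕ)
    (hu : ∑ i, u i ≤ j) :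
    ((markCount (N - j) k u * compCount N (N - j + ∑ i, u i) : ℕ) : ℚ) =
      DerivPartition.C j N u := by
  have hmark := markCount_mul (N - j) k u hk
  have hhook : ((∏ i : Fin k, (k - (i : ℕ) + ∑ g ∈ Ici i, u g) : ℕ) : ℚ) =
      ∏ i : Fin k, ((k : ℚ) - (i : ℕ) + ∑ g ∈ Ici i, (u g : ℚ)) := by
    push_cast
    exact prod_congr rfl fun i _ => by rw [Nat.cast_sub i.2.le]
  have hhook0 : (∏ i : Fin k, (k - (i : ℕ) + ∑ g ∈ Ici i, u g)) ≠ 0 :=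
    prod_ne_zero_iff.2 fun i _ => by have := i.2; omega
  have hfac0 : (∏ i, (u i).factorial) ≠ 0 := prod_ne_zero_iff.2 fun i _ => Nat.factorial_ne_zero _
  have hM : (N : ℚ) - j + ∑ i, (u i : ℚ) = ((N - j + ∑ i, u i : ℕ) : ℚ) := by
    push_cast [Nat.cast_sub hj.le]; ring
  have hprod : ∏ i, ((u i).factorial : ℚ) = ((∏ i, (u i).factorial : ℕ) : ℚ) := by push_cast; rfl
  obtain ⟨n, rfl⟩ := Nat.exists_eq_add_one_of_ne_zero (Nat.ne_zero_of_lt hj)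
  obtain ⟨M, hMs⟩ :=
    Nat.exists_eq_add_one_of_ne_zero (show n + 1 - j + ∑ i, u i ≠ 0 by omega)
  have hchoose := Nat.choose_mul_factorial_mul_factorial (show M ≤ n by omega)
  rw [show n - M = j - ∑ i, u i by omega] at hchoose
  rw [hMs, Nat.factorial_succ] at hmark
  rw [DerivPartition.C, ← hhook, hM, hMs, hprod, eq_div_iff]
  · norm_cast
    change _ * n.choose M * _ = n.factorial * _
    rw [← hchoose]
    linear_combination (n.choose M * (j - ∑ i, u i).factorial) * hmark
  · norm_cast
    exact mul_ne_zero (mul_ne_zero (mul_ne_zero (Nat.factorial_ne_zero _)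
      (Nat.factorial_ne_zero _)) hfac0) hhook0

end Constant

/-! ### Rings without identity -/

section NonUnital

/-- The evaluation of `F` in a ring with identity. When `j < ∑ u`, the truncated exponent is
harmless because `compCount` vanishes. -/
theorem F_eq_smul_prod {R : Type*} [CommRing R] (δ : R →+ R)
    (hδ : ∀ a b : R, δ (a * b) = a * δ b + δ a * b) (N j k : ℕ) (hj : j < N) (u : Fin k → ℕ)
    (f : Fin N → R) :
    DerivPartition.F δ j f u = (markCount (N - j) k u * compCount N (N - j + ∑ i, u i)) •
      δ^[N - (N - j + ∑ i, u i)] (∏ i, f i) := by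
  have h := sum_markedSum_blockTerm δ hδ f (N - j) univ k u
  rw [forestTerm, smul_smul, card_univ, Fintype.card_fin] at h
  rw [DerivPartition.F_eq δ j hj, ← h, setPartitions_eq, sum_comm]
  refine sum_congr rfl fun s _ => sum_congr rfl fun τ _ => ?_
  simp [blockTerm]

variable {R S : Type*} [NonUnitalCommRing R] [NonUnitalCommRing S]

/-- This holds for the adjoined identity too, since `DerivPartition.value 1 = 0`. -/
theorem map_value (φ : R →ₙ+* S) (x : WithOne R) :
    φ (DerivPartition.value x) = DerivPartition.value (WithOne.mapMulHom (φ : R →ₙ* S) x) := by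
  induction x using WithOne.recOneCoe with
  | one => simp [DerivPartition.value]
  | coe a => simp [DerivPartition.value]

theorem map_prodOver (φ : R →ₙ+* S) {ι : Type*} (A : Finset ι) (f : ι → R) :
    φ (DerivPartition.prodOver A f) = DerivPartition.prodOver A fun i => φ (f i) := by
  simp [DerivPartition.prodOver, map_value]

theorem map_F (φ : R →ₙ+* S) {δ : R → R} {ε : S → S} (h : ∀ a, φ (δ a) = ε (φ a)) {N : ℕ}
    (j : ℕ) (f : Fin N → R) {k : ℕ} (u : Fin k → ℕ) :
    φ (DerivPartition.F δ j f u) = DerivPartition.F ε j (fun i => φ (f i)) u := by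
  have hit : ∀ n a, φ (δ^[n] a) = ε^[n] (φ a) := fun n a =>
    Function.Semiconj.iterate_right (f := φ) h n a
  simp [DerivPartition.F, map_value, map_prodOver, hit]

/-- The extension of an additive map to the unitization that kills the identity. -/
def extendDerivation (δ : R →+ R) : Unitization ℤ R →+ Unitization ℤ R where
  toFun x := Unitization.inr (δ x.snd)
  map_zero' := by simp
  map_add' x y := by simp

theorem extendDerivation_mul (δ : R →+ R) (hδ : ∀ a b : R, δ (a * b) = a * δ b + δ a * b)
    (x y : Unitization ℤ R) :
    extendDerivation δ (x * y) = x * extendDerivation δ y + extendDerivation δ x * y := by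
  ext
  · simp [extendDerivation]
  · simp only [extendDerivation, AddMonoidHom.coe_mk, ZeroHom.coe_mk, Unitization.snd_mul,
      Unitization.snd_add, Unitization.fst_inr, Unitization.snd_inr, map_add, map_zsmul, hδ,
      zero_smul]
    abel

end NonUnital

end PartitionDerivation

theorem mainTheorem7 {R : Type*} [NonUnitalCommRing R] (δ : R →+ R)
    (hδ : ∀ a b : R, δ (a * b) = a * δ b + δ a * b)
    (N j k : ℕ) (hj : j < N) (hk : k ≤ N - j) (u : Fin k → ℕ) (f : Fin N → R) :
    (∑ i, u i ≤ j →
      ∃ c : ℕ, (c : ℚ) = DerivPartition.C j N u ∧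
        DerivPartition.F δ j f u =
          c • δ^[j - ∑ i, u i] (DerivPartition.prodOver Finset.univ f)) ∧
    (j < ∑ i, u i → DerivPartition.F δ j f u = 0) := by
  -- the identity is checked after embedding `R` into its unitization
  let φ : R →ₙ+* Unitization ℤ R := (Unitization.inrNonUnitalAlgHom ℤ R : R →ₙ+* Unitization ℤ R)
  have hφ : Function.Injective φ := Unitization.inr_injective
  have hcomm : ∀ a, φ (δ a) = PartitionDerivation.extendDerivation δ (φ a) := fun a => rfl
  have hne : (Finset.univ : Finset (Fin N)).Nonempty := ⟨⟨j, hj⟩, Finset.mem_univ _⟩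
  have hF : DerivPartition.F δ j f u =
      (PartitionDerivation.markCount (N - j) k u *
        PartitionDerivation.compCount N (N - j + ∑ i, u i)) •
      δ^[N - (N - j + ∑ i, u i)] (DerivPartition.prodOver Finset.univ f) := by
    apply hφ
    have hit : ∀ n a, φ (δ^[n] a) = (PartitionDerivation.extendDerivation δ)^[n] (φ a) :=
      fun n a => Function.Semiconj.iterate_right (f := φ) hcomm n a
    rw [PartitionDerivation.map_F φ hcomm, map_nsmul, hit, PartitionDerivation.map_prodOver,
      DerivPartition.prodOver_eq_prod _ _ hne]
    exact PartitionDerivation.F_eq_smul_prod _ (PartitionDerivation.extendDerivation_mul δ hδ)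
      N j k hj u _
  refine ⟨fun hu => ⟨_, PartitionDerivation.markCount_mul_compCount N j k hj hk u hu, ?_⟩,
    fun hu => ?_⟩
  · rw [hF, show N - (N - j + ∑ i, u i) = j - ∑ i, u i by omega]
  · rw [hF, PartitionDerivation.compCount_eq_zero (by omega), mul_zero, zero_smul]
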